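/- Let $\mathbb K$ be a field and let $F\in\mathbb K[x_0,\ldots,x_n]$ be a form of degree $d$. A Waring decomposition of $F$ over $\mathbb K$ is an expression $F=\sum_{i=1}^s c_iL_i^d$ with $c_i\in\mathbb K$ and linear forms $L_i$ with coefficients in $\mathbb K$; the Waring rank $\mathrm{rk}_{\mathbb K}(F)$ is the smallest $s$ for which such a decomposition exists. Let $n\geq 0$, let $a_1,\ldots,a_n\geq 1$ be integers, and let $M=x_0x_1^{a_1}\cdots x_n^{a_n}$. Then $M$ has Waring decompositions over $\mathbb C$ and over $\mathbb R$, and $$\mathrm{rk}_{\mathbb C}(M)=\mathrm{rk}_{\mathbb R}(M).$$ -/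

import Mathlib

/-- `F` has a Waring decomposition with `s` summands over the field `K`, as a form of degree `d`:
`F = ∑ cᵢ Lᵢ ^ d` with scalars `cᵢ ∈ K` and linear forms `Lᵢ` with coefficients in `K`. -/
def HasWaringDecomposition (K : Type*) [Field K] {σ : Type*} (d : ℕ)
    (F : MvPolynomial σ K) (s : ℕ) : Prop :=
  ∃ (c : Fin s → K) (L : Fin s → MvPolynomial σ K),
    (∀ i, (L i).IsHomogeneous 1) ∧ F = ∑ i, MvPolynomial.C (c i) * L i ^ d

/-- The Waring rank over `K` of a form `F` of degree `d`: the least number of summands in a Waring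
decomposition of `F` over `K` (with the value `0` if `F` has no Waring decomposition at all). -/
noncomputable def waringRank (K : Type*) [Field K] {σ : Type*} (d : ℕ)
    (F : MvPolynomial σ K) : ℕ :=
  sInf {s : ℕ | HasWaringDecomposition K d F s}

/-- The monomial `x₀ x₁ ^ a₁ ⋯ xₙ ^ aₙ` in `K[x₀, …, xₙ]`; the exponent of `x_{i+1}` is `a i`
for `i = 0, …, n - 1`. -/
noncomputable def leastOneMonomial (K : Type*) [Field K] {n : ℕ} (a : Fin n → ℕ) :
    MvPolynomial (Fin (n + 1)) K :=
  MvPolynomial.X 0 * ∏ i : Fin n, MvPolynomial.X i.succ ^ a i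

open MvPolynomial in
/-- The coefficients of a linear combination of powers of linear forms are, up to multinomial
coefficients, the moments of the corresponding weighted points. -/
theorem coeff_sum_C_mul_linear_pow {K : Type*} [Field K] {σ ι : Type*} [Fintype σ] [Fintype ι]
    (c : ι → K) (A : ι → σ → K) (d : ℕ) (k : σ →₀ ℕ) :
    coeff k (∑ j, C (c j) * (∑ i, A j i • X i : MvPolynomial σ K) ^ d) =
      if ∑ i, k i = d then k.multinomial * ∑ j, c j * ∏ i, A j i ^ k i else 0 := by
  have hk : (k.sum fun _ m => m) = ∑ i, k i := Finsupp.sum_fintype _ _ (fun _ => rfl)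
  simp only [coeff_sum, coeff_C_mul, coeff_linearCombination_X_pow_of_fintype, hk]
  split_ifs with h
  · rw [Finset.mul_sum]
    refine Finset.sum_congr rfl fun j _ => ?_
    rw [Finsupp.prod_fintype _ _ (fun _ => pow_zero _)]
    ring
  · simp

/-- A linear form is the linear combination of the variables given by its coefficients. -/
theorem MvPolynomial.IsHomogeneous.exists_eq_sum_smul_X {K : Type*} [Field K] {σ : Type*}
    [Fintype σ] {L : MvPolynomial σ K} (hL : L.IsHomogeneous 1) :
    ∃ A : σ → K, L = ∑ i, A i • MvPolynomial.X i := by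
  have h : L ∈ MvPolynomial.homogeneousSubmodule σ K 1 := hL
  rw [MvPolynomial.homogeneousSubmodule_one_eq_span_X, Submodule.mem_span_range_iff_exists_fun] at h
  obtain ⟨A, hA⟩ := h
  exact ⟨A, hA.symm⟩

/-- The exponent vector of `leastOneMonomial`. -/
noncomputable def leastOneExponent {n : ℕ} (a : Fin n → ℕ) : Fin (n + 1) →₀ ℕ :=
  Finsupp.equivFunOnFinite.symm (Fin.cons 1 a)

theorem leastOneMonomial_eq_monomial (K : Type*) [Field K] {n : ℕ} (a : Fin n → ℕ) :
    leastOneMonomial K a = MvPolynomial.monomial (leastOneExponent a) 1 := by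
  rw [MvPolynomial.monomial_eq, Finsupp.prod_fintype _ _ (fun _ => pow_zero _), Fin.prod_univ_succ]
  simp [leastOneMonomial, leastOneExponent]

theorem multinomial_cast_ne_zero (K : Type*) [Field K] [CharZero K] {σ : Type*} (k : σ →₀ ℕ) :
    (k.multinomial : K) ≠ 0 := by
  rw [Finsupp.multinomial_eq]
  exact_mod_cast (Nat.multinomial_pos _ _).ne'

/-- Nodes of zero sum and weights that pick out the exponent `m` among all exponents up to
`m + 1`. -/
theorem exists_nodes_weights (K : Type*) [Field K] [CharZero K] (m : ℕ) :
    ∃ t w : Fin (m + 1) → K, ∀ p ≤ m + 1, ∑ l, w l * t l ^ p = if p = m then 1 else 0 := by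
  classical
  -- Centring makes the nodes sum to zero, which is what kills the moment of order `m + 1`.
  let t : Fin (m + 1) → K := fun l => (l : K) - m / 2
  have ht : Function.Injective t := fun x y h => by
    have : ((x : ℕ) : K) = (y : ℕ) := by simpa [t] using h
    exact Fin.ext (by exact_mod_cast this)
  have hsum : ∑ l, t l = 0 := by
    have h1 : ∑ l : Fin (m + 1), ((l : ℕ) : K) = m * (m + 1) / 2 := by
      rw [Fin.sum_univ_eq_sum_range (fun l => (l : K)), eq_div_iff two_ne_zero]
      have := Finset.sum_range_id_mul_two (m + 1)
      rw [← Nat.cast_sum]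
      rw [Nat.add_sub_cancel] at this
      have h2 : (((∑ i ∈ Finset.range (m + 1), i) * 2 : ℕ) : K) = ((m + 1) * m : ℕ) := by rw [this]
      push_cast at h2 ⊢
      rw [h2]; ring
    simp only [t, Finset.sum_sub_distrib, h1]
    simp
    ring
  -- Divided-difference weights: they read off the coefficient of degree `m` of the Lagrange
  -- interpolant.
  refine ⟨t, fun l => (∏ j ∈ Finset.univ.erase l, (t l - t j))⁻¹, fun p hp => ?_⟩
  have key : ∀ P : Polynomial K, P.degree < (m + 1 : ℕ) →
      ∑ l, (∏ j ∈ Finset.univ.erase l, (t l - t j))⁻¹ * P.eval (t l) = P.coeff m := by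
    intro P hP
    have := Lagrange.coeff_eq_sum (s := Finset.univ) (v := t) ht.injOn (P := P) (by simpa using hP)
    simp only [Finset.card_univ, Fintype.card_fin, Nat.add_sub_cancel] at this
    rw [this]
    exact Finset.sum_congr rfl fun l _ => by rw [div_eq_inv_mul]
  rcases Nat.lt_or_ge m p with h | h
  · obtain rfl : p = m + 1 := by omega
    have hdeg : (Lagrange.nodal Finset.univ t).degree = (m + 1 : ℕ) := by
      rw [Lagrange.degree_nodal]; simp
    -- Subtracting the nodal polynomial keeps the values at the nodes and lowers the degree to at
    -- most `m`.
    have hP := key (Polynomial.X ^ (m + 1) - Lagrange.nodal Finset.univ t) (by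
      have := Polynomial.degree_sub_lt_left (p := (Polynomial.X : Polynomial K) ^ (m + 1))
        (q := Lagrange.nodal Finset.univ t) (by rw [hdeg, Polynomial.degree_X_pow])
        (pow_ne_zero _ Polynomial.X_ne_zero)
        (by rw [(Polynomial.monic_X_pow _).leadingCoeff, Lagrange.nodal_monic.leadingCoeff])
      rwa [Polynomial.degree_X_pow] at this)
    have hc : (Lagrange.nodal Finset.univ t).coeff m = 0 := by
      have := Polynomial.prod_X_sub_C_coeff_card_pred Finset.univ t (by simp)
      simpa [Lagrange.nodal_eq, hsum] using this
    simpa [Lagrange.eval_nodal_at_node, Polynomial.coeff_X_pow, hc] using hP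
  · have hP := key (Polynomial.X ^ p) (by
      rw [Polynomial.degree_X_pow]; exact_mod_cast Nat.lt_succ_of_le h)
    simpa [Polynomial.coeff_X_pow, eq_comm] using hP

/-- Summands indexed by an arbitrary finite type give a Waring decomposition. -/
theorem HasWaringDecomposition.of_fintype {K : Type*} [Field K] {σ ι : Type*} [Fintype ι]
    {d : ℕ} {F : MvPolynomial σ K} (c : ι → K) (L : ι → MvPolynomial σ K)
    (hL : ∀ i, (L i).IsHomogeneous 1) (hF : F = ∑ i, MvPolynomial.C (c i) * L i ^ d) :
    HasWaringDecomposition K d F (Fintype.card ι) := by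
  let e := (Fintype.equivFin ι).symm
  refine ⟨c ∘ e, L ∘ e, fun i => hL _, hF.trans ?_⟩
  exact (Equiv.sum_comp e fun i => MvPolynomial.C (c i) * L i ^ d).symm

theorem hasWaringDecomposition_leastOneMonomial (K : Type*) [Field K] [CharZero K] {n : ℕ}
    (a : Fin n → ℕ) :
    HasWaringDecomposition K (1 + ∑ i, a i) (leastOneMonomial K a) (∏ i, (a i + 1)) := by
  classical
  choose t w htw using fun i => exists_nodes_weights K (a i)
  have hcard : Fintype.card (∀ i, Fin (a i + 1)) = ∏ i, (a i + 1) := by simp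
  rw [← hcard]
  let A : (∀ i, Fin (a i + 1)) → Fin (n + 1) → K := fun u => Fin.cons 1 fun i => t i (u i)
  refine .of_fintype
    (fun u => ((leastOneExponent a).multinomial : K)⁻¹ * ∏ i, w i (u i))
    (fun u => ∑ i, A u i • MvPolynomial.X i) (fun u => ?_) ?_
  · refine .sum _ _ _ fun i _ => ?_
    rw [MvPolynomial.smul_eq_C_mul]
    exact MvPolynomial.isHomogeneous_C_mul_X _ _
  rw [leastOneMonomial_eq_monomial]
  ext k
  rw [coeff_sum_C_mul_linear_pow, MvPolynomial.coeff_monomial]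
  have hmom : ∑ u, (((leastOneExponent a).multinomial : K)⁻¹ * ∏ i, w i (u i)) *
      ∏ i, A u i ^ k i = ((leastOneExponent a).multinomial : K)⁻¹ *
        ∏ i, ∑ l, w i l * t i l ^ k i.succ := by
    rw [Fintype.prod_sum, Finset.mul_sum]
    refine Finset.sum_congr rfl fun u _ => ?_
    rw [Fin.prod_univ_succ, mul_assoc, Finset.prod_mul_distrib]
    simp [A]
  rw [hmom, Fin.sum_univ_succ]
  by_cases hk : leastOneExponent a = k
  · subst hk
    have hi : ∀ i : Fin n, leastOneExponent a i.succ = a i := fun i => by simp [leastOneExponent]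
    have h0 : leastOneExponent a 0 = 1 := by simp [leastOneExponent]
    rw [if_pos rfl, if_pos (by simp [hi, h0]), mul_inv_cancel_left₀ (multinomial_cast_ne_zero K _),
      Finset.prod_eq_one]
    intro i _
    rw [htw i _ (by rw [hi]; omega), if_pos (hi i)]
  · rw [if_neg hk]
    split_ifs with hd
    swap
    · rfl
    -- Otherwise every `k i.succ` is at least `a i`. As the exponent of `x₀` in the monomial is 1,
    -- the total excess is at most 1, so each is within the range `a i + 1` and hence equals `a i`.
    suffices h : ∃ i, k i.succ ≤ a i + 1 ∧ k i.succ ≠ a i by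
      obtain ⟨i, h1, h2⟩ := h
      rw [Finset.prod_eq_zero (Finset.mem_univ i) (by rw [htw i _ h1, if_neg h2]), mul_zero,
        mul_zero]
    by_contra! hcon
    have hge : ∀ i, a i ≤ k i.succ := fun i => by
      by_contra h
      exact h (hcon i (by omega)).ge
    have heq : ∀ i, k i.succ = a i := fun i => by
      refine hcon i ?_
      have h1 : ∑ j, a j + (k i.succ - a i) ≤ ∑ j, k (Fin.succ j) := by
        rw [← Finset.add_sum_erase _ _ (Finset.mem_univ i),
          ← Finset.add_sum_erase _ (fun j => k (Fin.succ j)) (Finset.mem_univ i)]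
        have := Finset.sum_le_sum fun j (_ : j ∈ Finset.univ.erase i) => hge j
        have := hge i
        omega
      omega
    refine hk (Finsupp.ext fun i => ?_)
    refine Fin.cases ?_ (fun i => ?_) i
    · simp only [heq] at hd
      simp [leastOneExponent]
      omega
    · simp [leastOneExponent, heq]

theorem prod_succ_le_of_hasWaringDecomposition (K : Type*) [Field K] [CharZero K] {n : ℕ}
    (a : Fin n → ℕ) {s : ℕ}
    (h : HasWaringDecomposition K (1 + ∑ i, a i) (leastOneMonomial K a) s) :
    ∏ i, (a i + 1) ≤ s := by
  classical
  obtain ⟨c, L, hL, hF⟩ := h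
  choose A hA using fun j => (hL j).exists_eq_sum_smul_X
  obtain rfl : L = fun j => ∑ i, A j i • MvPolynomial.X i := funext hA
  rw [leastOneMonomial_eq_monomial] at hF
  -- In degree `d` the only nonvanishing moment is that of the monomial itself.
  have hmom : ∀ (k₀ : ℕ) (k : Fin n → ℕ), k₀ + ∑ i, k i = 1 + ∑ i, a i →
      ((∑ j, c j * (A j 0 ^ k₀ * ∏ i, A j (Fin.succ i) ^ k i) ≠ 0) ↔ k = a) := by
    intro k₀ k hk
    have hsum : ∑ i, (Finsupp.equivFunOnFinite.symm (Fin.cons k₀ k : Fin (n + 1) → ℕ)) i =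
        1 + ∑ i, a i := by simpa [Fin.sum_univ_succ] using hk
    have h1 := congrArg
      (MvPolynomial.coeff (Finsupp.equivFunOnFinite.symm (Fin.cons k₀ k : Fin (n + 1) → ℕ))) hF
    rw [coeff_sum_C_mul_linear_pow, MvPolynomial.coeff_monomial,
      if_pos hsum] at h1
    simp only [Fin.prod_univ_succ, Finsupp.coe_equivFunOnFinite_symm, Fin.cons_zero,
      Fin.cons_succ] at h1
    have hm := multinomial_cast_ne_zero K
      (Finsupp.equivFunOnFinite.symm (Fin.cons k₀ k : Fin (n + 1) → ℕ))
    have hiff : leastOneExponent a =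
        Finsupp.equivFunOnFinite.symm (Fin.cons k₀ k : Fin (n + 1) → ℕ) ↔ k = a := by
      rw [leastOneExponent, Equiv.apply_eq_iff_eq, Fin.cons_inj]
      constructor
      · exact fun h => h.2.symm
      · rintro rfl
        exact ⟨by omega, rfl⟩
    rw [← hiff]
    split_ifs at h1 with h2
    · exact iff_of_true (fun h0 => by rw [h0] at h1; simp at h1) h2
    · exact iff_of_false (fun h0 => (mul_ne_zero hm h0) h1.symm) h2
  by_contra! hs
  -- a nonzero polynomial with exponents bounded by `a` vanishing at all the affine points
  let ev : ((∀ i, Fin (a i + 1)) → K) →ₗ[K] (Fin s → K) :=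
    LinearMap.pi fun j => Fintype.linearCombination K
      fun b : ∀ i, Fin (a i + 1) => ∏ i, (A j (Fin.succ i) / A j 0) ^ (b i : ℕ)
  have hker : LinearMap.ker ev ≠ ⊥ := LinearMap.ker_ne_bot_of_finrank_lt (by simpa using hs)
  obtain ⟨g, hg, hg0⟩ := (Submodule.ne_bot_iff _).1 hker
  have hgv : ∀ j, ∑ b, g b * ∏ i, (A j (Fin.succ i) / A j 0) ^ (b i : ℕ) = 0 := fun j => by
    simpa [ev, Fintype.linearCombination_apply] using congrFun (LinearMap.mem_ker.1 hg) j
  obtain ⟨b₀, hb₀, hmax⟩ := Finset.exists_max_image (Finset.univ.filter fun b => g b ≠ 0)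
    (fun b => ∑ i, (b i : ℕ)) (by
      obtain ⟨b, hb⟩ := Function.ne_iff.1 hg0
      exact ⟨b, by simpa using hb⟩)
  simp only [Finset.mem_filter, Finset.mem_univ, true_and] at hb₀ hmax
  have hle : ∀ i, (b₀ i : ℕ) ≤ a i := fun i => Nat.lt_succ_iff.1 (b₀ i).2
  -- its homogenization, multiplied by `y₀ y ^ (a - b₀)`, vanishes at all the points
  have hvan : ∀ j, ∑ b, g b * (A j 0 ^ (1 + ∑ i, (b₀ i : ℕ) - ∑ i, (b i : ℕ)) *
      ∏ i, A j (Fin.succ i) ^ ((b i : ℕ) + (a i - b₀ i))) = 0 := by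
    intro j
    -- At points at infinity the quotients above are junk; maximality of `b₀` leaves a positive
    -- power of `A j 0` in every term, which vanishes there.
    by_cases h0 : A j 0 = 0
    · refine Finset.sum_eq_zero fun b _ => ?_
      by_cases hb : g b = 0
      · rw [hb, zero_mul]
      · have := hmax b hb
        rw [h0, zero_pow (by omega), zero_mul, mul_zero]
    · calc _ = ∑ b, (A j 0 ^ (1 + ∑ i, (b₀ i : ℕ)) * ∏ i, A j (Fin.succ i) ^ (a i - b₀ i)) *
            (g b * ∏ i, (A j (Fin.succ i) / A j 0) ^ (b i : ℕ)) := by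
            refine Finset.sum_congr rfl fun b _ => ?_
            by_cases hb : g b = 0
            · simp [hb]
            have := hmax b hb
            simp only [pow_add _ (b _ : ℕ), Finset.prod_mul_distrib, div_pow, Finset.prod_div_distrib,
              Finset.prod_pow_eq_pow_sum]
            rw [pow_sub₀ _ h0 (by omega)]
            ring
        _ = 0 := by rw [← Finset.mul_sum, hgv, mul_zero]
  have hswap : ∑ b, g b * ∑ j, c j * (A j 0 ^ (1 + ∑ i, (b₀ i : ℕ) - ∑ i, (b i : ℕ)) *
      ∏ i, A j (Fin.succ i) ^ ((b i : ℕ) + (a i - b₀ i))) = 0 := by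
    simp only [Finset.mul_sum]
    rw [Finset.sum_comm]
    refine Finset.sum_eq_zero fun j _ => ?_
    simp only [mul_left_comm (g _) (c j)]
    rw [← Finset.mul_sum, hvan, mul_zero]
  have hexp : ∀ b, g b ≠ 0 → 1 + ∑ i, (b₀ i : ℕ) - ∑ i, (b i : ℕ) +
      ∑ i, ((b i : ℕ) + (a i - b₀ i)) = 1 + ∑ i, a i := by
    intro b hb
    have h1 := hmax b hb
    have h2 : ∑ i, (a i - b₀ i) + ∑ i, (b₀ i : ℕ) = ∑ i, a i := by
      rw [← Finset.sum_add_distrib]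
      exact Finset.sum_congr rfl fun i _ => Nat.sub_add_cancel (hle i)
    rw [Finset.sum_add_distrib]
    omega
  -- The exponent `b + (a - b₀)` equals `a` only for `b = b₀`, so a single nonzero term survives.
  rw [Finset.sum_eq_single b₀] at hswap
  · refine mul_ne_zero hb₀ ((hmom _ _ (hexp b₀ hb₀)).2 ?_) hswap
    exact funext fun i => Nat.add_sub_cancel' (hle i)
  · intro b _ hb
    by_cases hgb : g b = 0
    · rw [hgb, zero_mul]
    have := (hmom _ _ (hexp b hgb)).not.2 fun h => hb (funext fun i => Fin.ext (by
      have := congrFun h i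
      have := hle i
      omega))
    rw [not_not.1 this, mul_zero]
  · simp

/-- Over a field of characteristic zero the Waring rank of `x₀ x₁ ^ a₁ ⋯ xₙ ^ aₙ` is
`(a₁ + 1) ⋯ (aₙ + 1)`. -/
theorem waringRank_leastOneMonomial (K : Type*) [Field K] [CharZero K] {n : ℕ} (a : Fin n → ℕ) :
    waringRank K (1 + ∑ i, a i) (leastOneMonomial K a) = ∏ i, (a i + 1) :=
  le_antisymm (Nat.sInf_le (hasWaringDecomposition_leastOneMonomial K a))
    (le_csInf ⟨_, hasWaringDecomposition_leastOneMonomial K a⟩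
      fun _ h => prod_succ_le_of_hasWaringDecomposition K a h)

theorem corollary3p2 (n : ℕ) (a : Fin n → ℕ) (ha : ∀ i, 1 ≤ a i) :
    (∃ s, HasWaringDecomposition ℂ (1 + ∑ i, a i) (leastOneMonomial ℂ a) s) ∧
    (∃ s, HasWaringDecomposition ℝ (1 + ∑ i, a i) (leastOneMonomial ℝ a) s) ∧
    waringRank ℂ (1 + ∑ i, a i) (leastOneMonomial ℂ a) =
      waringRank ℝ (1 + ∑ i, a i) (leastOneMonomial ℝ a) :=
  ⟨⟨_, hasWaringDecomposition_leastOneMonomial ℂ a⟩,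
    ⟨_, hasWaringDecomposition_leastOneMonomial ℝ a⟩,
    (waringRank_leastOneMonomial ℂ a).trans (waringRank_leastOneMonomial ℝ a).symm⟩
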